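/- Let $\lambda_b,\lambda_l,\lambda_v>0$. Let $\Phi_v$ be a Poisson line Cox process: the lines $\{x\in\mathbb R^2: x_1\cos\theta+x_2\sin\theta=\rho\}$ are indexed by the points $(\rho,\theta)$ of a homogeneous Poisson point process of density $\lambda_l$ on $\mathbb R^+\times[0,2\pi)$, and, given the lines, the users (points of $\Phi_v$) form independent homogeneous one-dimensional Poisson processes of density $\lambda_v$ on the lines. For $A\subset\mathbb R^2$ let $N(A)$ be the number of users in $A$. Put $$g(a,b,c,x)=\frac{a\,b^{c/a}}{\Gamma(c/a)}x^{c-1}e^{-bx^a},\qquad f_Z(z)=\lambda_b\,g(1.07950,\,3.03226,\,3.31122,\,\lambda_b z)\quad(z>0),\qquad f_{R_t}(r)=2\pi r f_Z(\pi r^2)\quad(r>0),$$ $$\mathcal L(s)=\int_0^\infty \exp\Big[-2\pi\lambda_l r+2\pi\lambda_l\int_0^{r}e^{-2s\sqrt{r^2-\rho^2}}\,d\rho\Big]f_{R_t}(r)\,dr,\qquad p_m=\frac{(-\lambda_v)^m}{m!}\Big[\frac{\partial^m}{\partial s^m}\mathcal L(s)\Big]_{s=\lambda_v}\quad(m=0,1,2,\dots).$$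 The integral $\mathcal L(s)$ converges for every $s>0$ and $\mathcal L$ is infinitely differentiable on $(0,\infty)$. Moreover: (a) (Disc model with the fitted area law.) Let $Z$ be a random variable with density $f_Z$, independent of $\Phi_v$, and let $R_t=\sqrt{Z/\pi}$. Then the load $N(B(o,R_t))$ on the disc $B(o,R_t)$ of area $Z$ satisfies $\mathbb P(N(B(o,R_t))=m)=p_m$ for every $m\ge 0$. (b) (Approximation of the load on the typical cell.) Let the base stations form a homogeneous Poisson point process $\Phi_b$ of density $\lambda_b$ on $\mathbb R^2$, independent of $\Phi_v$, let $V_o=\{y:\|y\|\le\|y-x\|\ \forall x\in\Phi_b\}$ be the typical Poisson–Voronoi cell (that of a base station added at the origin $o$), let $M=N(V_o)$ be its load, and let $R_t=\sqrt{|V_o|/\pi}$, so that $B(o,R_t)$ has the same area as $V_o$. Then $\mathbb P(M=m)\approx p_m$, with an error due only to the two modelling assumptions: for every $m\ge0$, if $$|\mathbb P(M=m)-\mathbb P(N(B(o,R_t))=m)|\le\varepsilon\quad\text{and}\quad \Big|\mathbb P(|V_o|\in A)-\int_{A\cap(0,\infty)}f_Z(z)\,dz\Big|\le\delta\ \text{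 for all Borel } A\subset\mathbb R,$$ then $|\mathbb P(M=m)-p_m|\le\varepsilon+\delta$. In particular, if the number of users in $V_o$ has the same distribution as the number of users in $B(o,R_t)$ and $|V_o|$ has density $f_Z$, then $\mathbb P(M=m)=p_m$ for every $m\ge0$. -/

import Mathlib

open Real Set MeasureTheory ProbabilityTheory
open scoped ENNReal NNReal

noncomputable section

namespace VehicularLoad

/-- The Euclidean plane. -/
abbrev Plane : Type := EuclideanSpace ℝ (Fin 2)

/-- Number of points, counted with multiplicity, of the point process enumerated by `X` that lie
in `A`. -/
def count {Ω E : Type*} (X : ℕ → Ω → E) (A : Set E) (ω : Ω) : ℕ∞ :=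
  {i : ℕ | X i ω ∈ A}.encard

/-- The points `X 0, X 1, …` form a Poisson point process with intensity measure `Λ` (of infinite
total mass, so that there are infinitely many points): the number of points in a measurable set
of finite `Λ`-measure is Poisson with mean `Λ A`, and the numbers of points in pairwise disjoint
such sets are independent. -/
structure IsPoissonProcess {Ω E : Type*} [MeasurableSpace Ω] [MeasurableSpace E]
    (X : ℕ → Ω → E) (Λ : Measure E) (P : Measure Ω) : Prop where
  measurable : ∀ i, Measurable (X i)
  count_law : ∀ A : Set E, MeasurableSet A → Λ A ≠ ∞ → ∀ k : ℕ,
    P {ω | count X A ω = k} = poissonMeasure (Λ A).toNNReal {k}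
  indep : ∀ (n : ℕ) (A : Fin n → Set E), (∀ k, MeasurableSet (A k)) → (∀ k, Λ (A k) ≠ ∞) →
    Pairwise (fun k l => Disjoint (A k) (A l)) → iIndepFun (fun k => count X (A k)) P

/-- The homogeneous intensity measure with density `lam` on the representation space
`ℝ⁺ × [0, 2π)` of undirected lines. -/
def lineIntensity (lam : ℝ) : Measure (ℝ × ℝ) :=
  ENNReal.ofReal lam • volume.restrict (Ici 0 ×ˢ Ico 0 (2 * π))

/-- The point with signed arc-length coordinate `t`, measured from the foot of the perpendicular
from the origin, on the line `{x | x₁ cos θ + x₂ sin θ = ρ}`, where `l = (ρ, θ)`. -/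
def linePoint (l : ℝ × ℝ) (t : ℝ) : Plane :=
  !₂[l.1 * cos l.2 - t * sin l.2, l.1 * sin l.2 + t * cos l.2]

/-- All the randomness of the line Cox process: the lines and the positions on each of them. -/
def coxData {Ω : Type*} (L : ℕ → Ω → ℝ × ℝ) (Ψ : ℕ → ℕ → Ω → ℝ) (ω : Ω) :
    (ℕ → ℝ × ℝ) × (ℕ → ℕ → ℝ) :=
  (fun i => L i ω, fun i j => Ψ i j ω)

/-- A Poisson line Cox process: the lines `L i` are those of a motion-invariant Poisson line
process, with density `lamL` in representation space; on the `i`-th line the users sit at the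
arc-length coordinates `Ψ i 0, Ψ i 1, …`, a homogeneous Poisson process of density `lamV`; these
one-dimensional processes are independent of each other and of the lines. -/
structure IsPoissonLineCox {Ω : Type*} [MeasurableSpace Ω]
    (L : ℕ → Ω → ℝ × ℝ) (Ψ : ℕ → ℕ → Ω → ℝ) (lamL lamV : ℝ) (P : Measure Ω) : Prop where
  lines : IsPoissonProcess L (lineIntensity lamL) P
  users : ∀ i, IsPoissonProcess (Ψ i) (ENNReal.ofReal lamV • volume) P
  indep_users : iIndepFun (fun (i : ℕ) (ω : Ω) (j : ℕ) => Ψ i j ω) P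
  indep_lines : IndepFun (fun (ω : Ω) (i : ℕ) => L i ω) (fun (ω : Ω) (i j : ℕ) => Ψ i j ω) P

/-- Number of users of the line Cox process in the region `A`. -/
def userCount {Ω : Type*} (L : ℕ → Ω → ℝ × ℝ) (Ψ : ℕ → ℕ → Ω → ℝ) (A : Set Plane) (ω : Ω) : ℕ∞ :=
  {p : ℕ × ℕ | linePoint (L p.1 ω) (Ψ p.1 p.2 ω) ∈ A}.encard

/-- The Voronoi cell of `x` with respect to the point set `S`. -/
def voronoiCell (S : Set Plane) (x : Plane) : Set Plane :=
  {y | ∀ x' ∈ S, ‖y - x‖ ≤ ‖y - x'‖}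

/-- The typical cell: the cell of a base station at the origin, added to the base stations
`Φ 0, Φ 1, …` -/
def typicalCell {Ω : Type*} (Φ : ℕ → Ω → Plane) (ω : Ω) : Set Plane :=
  voronoiCell (insert 0 (range fun i => Φ i ω)) 0

/-- The disc centred at the origin with area `z`. -/
def discOfArea (z : ℝ) : Set Plane := Metric.closedBall 0 √(z / π)

/-- The generalized gamma density `g(a, b, c, x)`. -/
def genGamma (a b c x : ℝ) : ℝ :=
  a * b ^ (c / a) * (Gamma (c / a))⁻¹ * x ^ (c - 1) * exp (-b * x ^ a)

/-- The fitted density `f_Z` of the area of the typical cell. -/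
def areaPDF (lamB z : ℝ) : ℝ := lamB * genGamma 1.07950 3.03226 3.31122 (lamB * z)

/-- The fitted law of the area of the typical cell. -/
def areaLaw (lamB : ℝ) : Measure ℝ :=
  (volume.restrict (Ioi 0)).withDensity fun z => ENNReal.ofReal (areaPDF lamB z)

/-- The density of the radius of a disc whose area has density `f_Z`. -/
def radiusPDF (lamB r : ℝ) : ℝ := 2 * π * r * areaPDF lamB (π * r ^ 2)

/-- The integrand, as a function of the radius `r`, of the approximate Laplace transform. -/
def laplaceIntegrand (lamB lamL s r : ℝ) : ℝ :=
  exp (-2 * π * lamL * r + 2 * π * lamL * ∫ ρ in (0 : ℝ)..r, exp (-2 * s * √(r ^ 2 - ρ ^ 2)))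
    * radiusPDF lamB r

/-- The approximate Laplace transform of the total chord length. -/
def approxLaplace (lamB lamL s : ℝ) : ℝ := ∫ r in Ioi 0, laplaceIntegrand lamB lamL s r

/-- The approximate probability that the load equals `m`. -/
def approxLoadPMF (lamB lamL lamV : ℝ) (m : ℕ) : ℝ :=
  (-lamV) ^ m / (m.factorial : ℝ) * iteratedDeriv m (fun s => approxLaplace lamB lamL s) lamV

end VehicularLoad

end

/-! Fix a radius `r` and let `T` be the total chord length of the lines in the centred disc. Given
the lines, the users on the hitting chords are independent Poisson counts, so the load is Poisson
with mean `lamV * T` (`IsPoissonLineCox.measureReal_discLoad_eq`). The Laplace functional of the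
line process (`IsPoissonProcess.integral_exp_neg_pointSum`) evaluates `E exp(-s T)` as the
exponential inside the integral for `approxLaplace`.

Substituting `z = π r ^ 2` makes `approxLaplace` the moment generating function of `-T` under (area
law) × `P`. Since `T ≥ 0`, it is finite for `s ≥ 0`, hence analytic for `s > 0`, with `m`-th
derivative `E[(-T) ^ m exp(-s T)]`. Multiplying by `(-lamV) ^ m / m!` at `s = lamV` gives the mixed
Poisson probability, so `approxLoadPMF` is the load law of the disc averaged over the area law
(`approxLoadPMF_eq_integral`).

An area independent of the Cox process can be frozen, which gives (a). For (b), the disc probability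
is a `[0, 1]`-valued function of the area, so replacing the true area law by the fitted one costs at
most `δ`; the triangle inequality adds `ε`. -/

namespace VehicularLoad

/-! ### Poisson processes: counts and the Laplace functional -/

section Poisson

variable {Ω E : Type*}

theorem tsum_indicator_one_eq_encard {ι : Type*} (s : Set ι) :
    ∑' i, s.indicator (fun _ => (1 : ℝ≥0∞)) i = (s.encard : ℝ≥0∞) := by
  rw [← tsum_subtype, ENNReal.tsum_set_one]

/-- The cardinality is a countable sum of indicators in `ℝ≥0∞`, into which `ℕ∞` embeds injectively.
-/
theorem measurable_encard_setOf {α ι : Type*} [Countable ι] [MeasurableSpace α] {S : ι → Set α}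
    (hS : ∀ i, MeasurableSet (S i)) : Measurable fun a => {i | a ∈ S i}.encard := by
  have h : Measurable fun a => ∑' i, (S i).indicator (fun _ => (1 : ℝ≥0∞)) a :=
    Measurable.tsum fun i => measurable_const.indicator (hS i)
  refine ENat.measurable_iff.2 fun n => ?_
  convert h (measurableSet_singleton (n : ℝ≥0∞)) using 1
  ext a
  have : ∑' i, (S i).indicator (fun _ => (1 : ℝ≥0∞)) a = ({i | a ∈ S i}.encard : ℝ≥0∞) := by
    rw [← tsum_indicator_one_eq_encard]
    exact tsum_congr fun i => by by_cases h : a ∈ S i <;> simp [h]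
  simp only [mem_preimage, mem_singleton_iff, this]
  rw [← ENat.toENNReal_inj]
  simp

theorem integral_exp_neg_mul_poissonMeasure (r : ℝ≥0) (a : ℝ) :
    ∫ n : ℕ, exp (-(a * n)) ∂poissonMeasure r = exp (-(r * (1 - exp (-a)))) := by
  rw [integral_poissonMeasure]
  have h := NormedSpace.expSeries_div_hasSum_exp (𝔸 := ℝ) (r * exp (-a))
  rw [← Real.exp_eq_exp_ℝ] at h
  have h2 := h.mul_left (exp (-r))
  rw [← Real.exp_add] at h2
  rw [show -(r * (1 - exp (-a))) = -r + r * exp (-a) by ring, ← h2.tsum_eq]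
  refine tsum_congr fun n => ?_
  rw [mul_pow, ← Real.exp_nat_mul, smul_eq_mul, show (n : ℝ) * -a = -(a * n) by ring]
  ring

theorem hasLaw_sum_poissonMeasure {ι : Type*} [MeasurableSpace Ω] {P : Measure Ω}
    [IsProbabilityMeasure P] {N : ι → Ω → ℕ} {r : ι → ℝ≥0} (hmeas : ∀ i, Measurable (N i)) (hN : iIndepFun N P)
    (hlaw : ∀ i, HasLaw (N i) (poissonMeasure (r i)) P) (s : Finset ι) :
    HasLaw (∑ i ∈ s, N i) (poissonMeasure (∑ i ∈ s, r i)) P := by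
  classical
  induction s using Finset.induction_on with
  | empty =>
    refine ⟨by fun_prop, ?_⟩
    refine Measure.ext_of_singleton fun k => ?_
    rw [Measure.map_apply (by fun_prop) (measurableSet_singleton k), poissonMeasure_singleton]
    rcases Nat.eq_zero_or_pos k with rfl | hk
    · have : ((∑ i ∈ (∅ : Finset ι), N i) ⁻¹' {0} : Set Ω) = univ := by
        ext ω; simp
      rw [this]
      simp
    · have : ((∑ i ∈ (∅ : Finset ι), N i) ⁻¹' {k} : Set Ω) = ∅ := by
        ext ω; simp [hk.ne]
      rw [this]
      simp [hk.ne']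
  | insert i s hi ih =>
    rw [Finset.sum_insert hi, Finset.sum_insert hi]
    exact (hN.indepFun_finsetSum_of_notMem hmeas hi).symm.hasLaw_add_poissonMeasure (hlaw i) ih

namespace IsPoissonProcess

variable [MeasurableSpace Ω] [MeasurableSpace E] {X : ℕ → Ω → E} {Λ : Measure E}
  {P : Measure Ω} {A : Set E}

theorem measurable_count (hX : IsPoissonProcess X Λ P) (hA : MeasurableSet A) :
    Measurable (count X A) :=
  measurable_encard_setOf (S := fun i => X i ⁻¹' A) fun i => hX.measurable i hA

theorem iIndepFun_count {ι : Type*} [Fintype ι] (hX : IsPoissonProcess X Λ P) {A : ι → Set E}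
    (hA : ∀ k, MeasurableSet (A k)) (hΛ : ∀ k, Λ (A k) ≠ ∞)
    (hd : Pairwise fun k l => Disjoint (A k) (A l)) : iIndepFun (fun k => count X (A k)) P := by
  let e := Fintype.equivFin ι
  have h := hX.indep (Fintype.card ι) (fun k => A (e.symm k)) (fun k => hA _) (fun k => hΛ _)
    (fun k l hkl => hd (e.symm.injective.ne hkl))
  simpa [Function.comp_def] using h.precomp e.injective

variable [IsProbabilityMeasure P]

/-- The Poisson masses of the finite values already sum to one, leaving nothing for `⊤`. -/
theorem ae_count_ne_top (hX : IsPoissonProcess X Λ P) (hA : MeasurableSet A) (hΛ : Λ A ≠ ∞) :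
    ∀ᵐ ω ∂P, count X A ω ≠ ⊤ := by
  have hm (k : ℕ) : MeasurableSet {ω | count X A ω = k} :=
    hX.measurable_count hA (measurableSet_singleton (k : ℕ∞))
  have hU : {ω | count X A ω ≠ ⊤} = ⋃ k : ℕ, {ω | count X A ω = k} := by
    ext ω
    rw [mem_ofPred_eq, ENat.ne_top_iff_exists]
    simp [eq_comm]
  have hmU : MeasurableSet {ω | count X A ω ≠ ⊤} := hU ▸ MeasurableSet.iUnion hm
  have h1 : P {ω | count X A ω ≠ ⊤} = 1 := by
    rw [hU, measure_iUnion _ hm]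
    · simp_rw [hX.count_law A hA hΛ]
      have h := measure_iUnion (μ := poissonMeasure (Λ A).toNNReal)
        (f := fun k : ℕ => ({k} : Set ℕ)) (fun i j hij => by simpa using hij) (fun _ => by simp)
      rw [← h, iUnion_of_singleton, measure_univ]
    · intro i j hij
      rw [Function.onFun, disjoint_left]
      intro ω hi hj
      simp only [mem_ofPred_eq] at hi hj
      exact hij (by exact_mod_cast hi.symm.trans hj)
  exact (prob_compl_eq_zero_iff hmU).2 h1

theorem hasLaw_toNat_count (hX : IsPoissonProcess X Λ P) (hA : MeasurableSet A)
    (hΛ : Λ A ≠ ∞) :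
    HasLaw (fun ω => (count X A ω).toNat) (poissonMeasure (Λ A).toNNReal) P := by
  have hm : Measurable fun ω => (count X A ω).toNat :=
    (Measurable.of_discrete (f := ENat.toNat)).comp (hX.measurable_count hA)
  refine ⟨hm.aemeasurable, Measure.ext_of_singleton fun k => ?_⟩
  rw [Measure.map_apply hm (measurableSet_singleton k), ← hX.count_law A hA hΛ k]
  refine measure_congr ?_
  filter_upwards [hX.ae_count_ne_top hA hΛ] with ω hω
  obtain ⟨n, hn⟩ := ENat.ne_top_iff_exists.1 hω
  change (((count X A ω).toNat = k) : Prop) = (count X A ω = k)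
  rw [← hn]
  simp

end IsPoissonProcess

/-- The sum of the values of `f` over the points of the process `X`. -/
noncomputable def pointSum {Ω E : Type*} (X : ℕ → Ω → E) (f : E → ℝ≥0) (ω : Ω) : ℝ≥0∞ :=
  ∑' i, (f (X i ω) : ℝ≥0∞)

theorem pointSum_eq_sum {X : ℕ → Ω → E} {f : E → ℝ≥0} {A : Set E} {ω : Ω}
    (hf : ∀ x ∉ A, f x = 0) (h : {i | X i ω ∈ A}.Finite) :
    pointSum X f ω = ((∑ i ∈ h.toFinset, f (X i ω) : ℝ≥0) : ℝ≥0∞) := by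
  rw [pointSum, tsum_eq_sum (s := h.toFinset)]
  · simp
  · intro i hi
    simp only [Finite.mem_toFinset, mem_ofPred_eq] at hi
    simp [hf _ hi]

/-- The value `0` is dropped because its level set may have infinite intensity, where no count law
is available. -/
theorem pointSum_simpleFunc [MeasurableSpace E] (X : ℕ → Ω → E) (f : SimpleFunc E ℝ≥0) (ω : Ω) :
    pointSum X f ω
      = ∑ y ∈ f.range.erase 0, (y : ℝ≥0∞) * (count X (f ⁻¹' {y}) ω : ℝ≥0∞) := by
  have h1 (x : E) : (f x : ℝ≥0∞)
      = ∑ y ∈ f.range.erase 0, (y : ℝ≥0∞) * (f ⁻¹' {y}).indicator (fun _ => 1) x := by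
    by_cases hx : f x = 0
    · rw [hx, Finset.sum_eq_zero]
      · simp
      · intro y hy
        have : y ≠ 0 := (Finset.mem_erase.1 hy).1
        simp [hx, this.symm]
    · rw [Finset.sum_eq_single (f x)]
      · simp
      · intro y _ hy
        simp [hy.symm]
      · intro h
        exact absurd (Finset.mem_erase.2 ⟨hx, f.mem_range_self x⟩) h
  unfold pointSum
  simp_rw [h1]
  rw [Summable.tsum_finsetSum fun _ _ => ENNReal.summable]
  refine Finset.sum_congr rfl fun y _ => ?_
  rw [ENNReal.tsum_mul_left, count, ← tsum_indicator_one_eq_encard]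
  rfl

theorem measurable_pointSum [MeasurableSpace Ω] [MeasurableSpace E] {X : ℕ → Ω → E}
    (hX : ∀ i, Measurable (X i)) {f : E → ℝ≥0} (hf : Measurable f) : Measurable (pointSum X f) := by
  unfold pointSum
  fun_prop

namespace IsPoissonProcess

variable [MeasurableSpace Ω] [MeasurableSpace E] {X : ℕ → Ω → E} {Λ : Measure E}
  {P : Measure Ω} [IsProbabilityMeasure P] {A : Set E}

theorem ae_finite (hX : IsPoissonProcess X Λ P) (hA : MeasurableSet A) (hΛ : Λ A ≠ ∞) :
    ∀ᵐ ω ∂P, {i | X i ω ∈ A}.Finite := by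
  filter_upwards [hX.ae_count_ne_top hA hΛ] with ω hω
  exact encard_ne_top_iff.1 hω

/-- The nonzero level sets are disjoint and lie in `A`, so their counts are independent Poisson
variables: the expectation factors, and each factor is a Poisson Laplace transform. -/
theorem integral_exp_neg_pointSum_simpleFunc (hX : IsPoissonProcess X Λ P)
    (hΛ : Λ A ≠ ∞) (f : SimpleFunc E ℝ≥0) (hf : ∀ x ∉ A, f x = 0) :
    ∫ ω, exp (-(pointSum X f ω).toReal) ∂P = exp (-∫ x in A, (1 - exp (-f x)) ∂Λ) := by
  classical
  set s := f.range.erase 0 with hs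
  have hm (y : ℝ≥0) : MeasurableSet (f ⁻¹' {y}) := f.measurableSet_preimage _
  have hsub (y : s) : f ⁻¹' {(y : ℝ≥0)} ⊆ A := by
    intro x hx
    by_contra hxA
    have h0 : (y : ℝ≥0) ≠ 0 := (Finset.mem_erase.1 y.2).1
    exact h0 (by rw [← hf x hxA]; exact hx.symm)
  have hfin (y : s) : Λ (f ⁻¹' {(y : ℝ≥0)}) ≠ ∞ := measure_ne_top_of_subset (hsub y) hΛ
  have hind : iIndepFun (fun y : s => count X (f ⁻¹' {(y : ℝ≥0)})) P := by
    refine hX.iIndepFun_count (fun y => hm _) hfin fun y z hyz => ?_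
    refine disjoint_left.2 ?_
    intro x hx hx'
    exact hyz (Subtype.ext (hx.symm.trans hx'))
  have hae : ∀ᵐ ω ∂P, ∀ y : s, count X (f ⁻¹' {(y : ℝ≥0)}) ω ≠ ⊤ :=
    ae_all_iff.2 fun y => hX.ae_count_ne_top (hm _) (hfin y)
  calc ∫ ω, exp (-(pointSum X f ω).toReal) ∂P
      = ∫ ω, ∏ y : s, exp (-((y : ℝ≥0) * ((count X (f ⁻¹' {(y : ℝ≥0)}) ω).toNat : ℝ))) ∂P := by
        refine integral_congr_ae ?_
        filter_upwards [hae] with ω hω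
        rw [pointSum_simpleFunc, ← hs, ← Finset.sum_coe_sort, ENNReal.toReal_sum,
          ← Finset.sum_neg_distrib, Real.exp_sum]
        · refine Finset.prod_congr rfl fun y _ => ?_
          obtain ⟨n, hn⟩ := ENat.ne_top_iff_exists.1 (hω y)
          rw [← hn]
          simp
        · intro y _
          obtain ⟨n, hn⟩ := ENat.ne_top_iff_exists.1 (hω y)
          rw [← hn]
          exact ENNReal.mul_ne_top ENNReal.coe_ne_top (by simp)
    _ = ∏ y : s, ∫ ω, exp (-((y : ℝ≥0) * ((count X (f ⁻¹' {(y : ℝ≥0)}) ω).toNat : ℝ))) ∂P :=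
        hind.integral_fun_prod_comp (f := fun (y : s) (n : ℕ∞) => exp (-((y : ℝ≥0) * (n.toNat : ℝ))))
          (fun y => (hX.measurable_count (hm _)).aemeasurable)
          (fun y => (Measurable.of_discrete).aestronglyMeasurable)
    _ = ∏ y : s, exp (-(Λ.real (f ⁻¹' {(y : ℝ≥0)}) * (1 - exp (-(y : ℝ≥0))))) := by
        refine Finset.prod_congr rfl fun y _ => ?_
        have hl := hX.hasLaw_toNat_count (hm y) (hfin y)
        have := hl.integral_comp (f := fun n : ℕ => exp (-((y : ℝ≥0) * (n : ℝ))))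
          (Measurable.of_discrete).aestronglyMeasurable
        rw [integral_exp_neg_mul_poissonMeasure] at this
        exact this
    _ = exp (-∫ x in A, (1 - exp (-f x)) ∂Λ) := by
        rw [← Real.exp_sum, Finset.sum_neg_distrib]
        congr 2
        have h1 (x : E) : 1 - exp (-(f x : ℝ))
            = ∑ y : s, (f ⁻¹' {(y : ℝ≥0)}).indicator (fun _ => 1 - exp (-((y : ℝ≥0) : ℝ))) x := by
          by_cases hx : f x = 0
          · rw [hx, Finset.sum_eq_zero]
            · simp
            · intro y hy
              have : (y : ℝ≥0) ≠ 0 := (Finset.mem_erase.1 y.2).1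
              simp [hx, this.symm]
          · rw [Finset.sum_eq_single ⟨f x, Finset.mem_erase.2 ⟨hx, f.mem_range_self x⟩⟩]
            · simp
            · intro y _ hy
              have : f x ≠ y := fun h => hy (Subtype.ext h.symm)
              simp [this]
            · simp
        simp_rw [h1]
        rw [integral_finsetSum]
        · refine Finset.sum_congr rfl fun y _ => ?_
          rw [integral_indicator_const _ (hm _), measureReal_restrict_apply (hm _),
            inter_eq_left.2 (hsub y), smul_eq_mul]
        · intro y _
          have : IsFiniteMeasure (Λ.restrict A) := ⟨by simpa using hΛ.lt_top⟩
          exact (integrable_const _).indicator (hm _)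

/-- The Laplace functional of a Poisson process. -/
theorem integral_exp_neg_pointSum (hX : IsPoissonProcess X Λ P)
    (hA : MeasurableSet A) (hΛ : Λ A ≠ ∞) {f : E → ℝ≥0} (hfm : Measurable f)
    (hf : ∀ x ∉ A, f x = 0) :
    ∫ ω, exp (-(pointSum X f ω).toReal) ∂P = exp (-∫ x in A, (1 - exp (-f x)) ∂Λ) := by
  have : IsFiniteMeasure (Λ.restrict A) := ⟨by simpa using hΛ.lt_top⟩
  -- Restricting to `A` keeps every approximant zero off `A`, as the simple case requires.
  let g (n : ℕ) : SimpleFunc E ℝ≥0 := (hfm.stronglyMeasurable.approx n).restrict A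
  have hg0 (n : ℕ) (x : E) (hx : x ∉ A) : g n x = 0 := by
    simp [g, SimpleFunc.restrict_apply _ hA, hx]
  have hgt (x : E) : Filter.Tendsto (fun n => g n x) Filter.atTop (nhds (f x)) := by
    by_cases hx : x ∈ A
    · simpa [g, SimpleFunc.restrict_apply _ hA, hx]
        using hfm.stronglyMeasurable.tendsto_approx x
    · simp [hg0 _ x hx, hf x hx]
  have hl : Filter.Tendsto (fun n => ∫ ω, exp (-(pointSum X (g n) ω).toReal) ∂P) Filter.atTop
      (nhds (∫ ω, exp (-(pointSum X f ω).toReal) ∂P)) := by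
    refine tendsto_integral_of_dominated_convergence (fun _ => 1) (fun n => ?_)
      (integrable_const _) (fun n => ?_) ?_
    · have := measurable_pointSum hX.measurable (g n).measurable
      exact (by fun_prop : Measurable _).aestronglyMeasurable
    · refine Filter.Eventually.of_forall fun ω => ?_
      rw [Real.norm_eq_abs, abs_of_pos (exp_pos _)]
      exact exp_le_one_iff.2 (neg_nonpos.2 ENNReal.toReal_nonneg)
    -- Almost surely only finitely many points lie in `A`, so pointwise convergence passes through a
    -- finite sum.
    · filter_upwards [hX.ae_finite hA hΛ] with ω hω
      simp_rw [pointSum_eq_sum (hg0 _) hω, pointSum_eq_sum hf hω, ENNReal.coe_toReal]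
      refine (Real.continuous_exp.tendsto _).comp (Filter.Tendsto.neg ?_)
      exact (NNReal.continuous_coe.tendsto _).comp (tendsto_finsetSum _ fun i _ => hgt _)
  have hr : Filter.Tendsto (fun n => exp (-∫ x in A, (1 - exp (-g n x)) ∂Λ)) Filter.atTop
      (nhds (exp (-∫ x in A, (1 - exp (-f x)) ∂Λ))) := by
    refine (Real.continuous_exp.tendsto _).comp (Filter.Tendsto.neg ?_)
    refine tendsto_integral_of_dominated_convergence (fun _ => 1) (fun n => ?_)
      (integrable_const _) (fun n => ?_) ?_
    · have := (g n).measurable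
      exact (by fun_prop : Measurable _).aestronglyMeasurable
    · refine Filter.Eventually.of_forall fun x => ?_
      have h1 : exp (-(g n x : ℝ)) ≤ 1 := exp_le_one_iff.2 (neg_nonpos.2 (g n x).2)
      have h2 := exp_pos (-(g n x : ℝ))
      rw [Real.norm_eq_abs, abs_le]
      constructor <;> linarith
    · refine Filter.Eventually.of_forall fun x => ?_
      refine Filter.Tendsto.sub tendsto_const_nhds ?_
      refine (Real.continuous_exp.tendsto _).comp (Filter.Tendsto.neg ?_)
      exact (NNReal.continuous_coe.tendsto _).comp (hgt _)
  refine tendsto_nhds_unique hl ?_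
  simp_rw [fun n => hX.integral_exp_neg_pointSum_simpleFunc hΛ (g n) (hg0 n)]
  exact hr

end IsPoissonProcess

end Poisson

/-! ### Lines, chords and the intensity of lines hitting a disc -/

section Geometry

/-- The length of the chord cut out of the line `l` by the disc of radius `r` about the origin. -/
noncomputable def chordLength (r : ℝ) (l : ℝ × ℝ) : ℝ≥0 := (2 * √(r ^ 2 - l.1 ^ 2)).toNNReal

/-- The lines that meet the disc of radius `r` about the origin. -/
def hittingLines (r : ℝ) : Set (ℝ × ℝ) := {l | l.1 ^ 2 ≤ r ^ 2}

theorem coe_chordLength (r : ℝ) (l : ℝ × ℝ) : (chordLength r l : ℝ) = 2 * √(r ^ 2 - l.1 ^ 2) :=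
  Real.coe_toNNReal _ (by positivity)

theorem measurable_chordLength (r : ℝ) : Measurable (chordLength r) := by
  unfold chordLength
  fun_prop

theorem chordLength_eq_zero {r : ℝ} {l : ℝ × ℝ} (hl : l ∉ hittingLines r) :
    chordLength r l = 0 := by
  have : r ^ 2 < l.1 ^ 2 := not_le.1 hl
  rw [chordLength, Real.sqrt_eq_zero_of_nonpos (by linarith)]
  simp

theorem measurableSet_hittingLines (r : ℝ) : MeasurableSet (hittingLines r) :=
  measurableSet_le (by fun_prop) (by fun_prop)

/-- `(ρ, t)` are the coordinates in an orthonormal frame rotated by `θ`, so the angle drops out. -/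
theorem linePoint_mem_closedBall {r : ℝ} (hr : 0 ≤ r) (l : ℝ × ℝ) (t : ℝ) :
    linePoint l t ∈ Metric.closedBall (0 : Plane) r ↔ l.1 ^ 2 + t ^ 2 ≤ r ^ 2 := by
  rw [mem_closedBall_zero_iff, ← sq_le_sq₀ (norm_nonneg _) hr, EuclideanSpace.norm_sq_eq]
  simp only [linePoint, Fin.sum_univ_two, Real.norm_eq_abs, sq_abs]
  simp only [Matrix.cons_val_zero, Matrix.cons_val_one]
  have h := Real.sin_sq_add_cos_sq l.2
  have : (l.1 * cos l.2 - t * sin l.2) ^ 2 + (l.1 * sin l.2 + t * cos l.2) ^ 2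
      = l.1 ^ 2 + t ^ 2 := by
    linear_combination (l.1 ^ 2 + t ^ 2) * h
  rw [this]

/-- A line missing the disc is covered too, since `√` vanishes on negative numbers. -/
theorem volume_setOf_sq_add_sq_le (r : ℝ) (l : ℝ × ℝ) :
    volume {t : ℝ | l.1 ^ 2 + t ^ 2 ≤ r ^ 2} = chordLength r l := by
  by_cases hl : l ∈ hittingLines r
  · have hl' : l.1 ^ 2 ≤ r ^ 2 := hl
    have : {t : ℝ | l.1 ^ 2 + t ^ 2 ≤ r ^ 2}
        = Icc (-√(r ^ 2 - l.1 ^ 2)) (√(r ^ 2 - l.1 ^ 2)) := by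
      ext t
      rw [mem_Icc, ← abs_le, Real.le_sqrt (abs_nonneg t) (by linarith), sq_abs, mem_ofPred_eq]
      constructor <;> intro h <;> linarith
    rw [this, Real.volume_Icc, chordLength, ENNReal.ofReal]
    congr 2
    ring
  · have hl' : r ^ 2 < l.1 ^ 2 := not_le.1 hl
    have : {t : ℝ | l.1 ^ 2 + t ^ 2 ≤ r ^ 2} = ∅ := by
      ext t
      simp only [mem_ofPred_eq, mem_empty_iff_false, iff_false, not_le]
      nlinarith [sq_nonneg t]
    rw [this, chordLength_eq_zero hl]
    simp

theorem lineIntensity_restrict_hittingLines {r : ℝ} (hr : 0 ≤ r) (lam : ℝ) :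
    (lineIntensity lam).restrict (hittingLines r) = ENNReal.ofReal lam •
      (volume.restrict (Icc 0 r)).prod (volume.restrict (Ico 0 (2 * π))) := by
  rw [lineIntensity, Measure.restrict_smul, Measure.restrict_restrict (measurableSet_hittingLines r),
    Measure.prod_restrict, ← Measure.volume_eq_prod]
  congr 2
  ext ⟨ρ, θ⟩
  simp only [hittingLines, mem_inter_iff, mem_ofPred_eq, mem_prod, mem_Ici, mem_Icc]
  constructor
  · rintro ⟨h, h0, h1⟩
    exact ⟨⟨h0, (sq_le_sq₀ h0 hr).1 h⟩, h1⟩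
  · rintro ⟨⟨h0, h⟩, h1⟩
    exact ⟨(sq_le_sq₀ h0 hr).2 h, h0, h1⟩

theorem lineIntensity_hittingLines_ne_top {r : ℝ} (hr : 0 ≤ r) (lam : ℝ) :
    lineIntensity lam (hittingLines r) ≠ ∞ := by
  rw [← Measure.restrict_apply_univ, lineIntensity_restrict_hittingLines hr]
  simp only [Measure.smul_apply, Measure.prod_apply .univ, smul_eq_mul]
  simp [ENNReal.mul_eq_top]

theorem setIntegral_hittingLines {r lam : ℝ} (hr : 0 ≤ r) (hlam : 0 ≤ lam) (g : ℝ → ℝ) :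
    ∫ l in hittingLines r, g l.1 ∂lineIntensity lam = 2 * π * lam * ∫ ρ in (0 : ℝ)..r, g ρ := by
  rw [lineIntensity_restrict_hittingLines hr, integral_smul_measure, integral_fun_fst,
    intervalIntegral.integral_of_le hr, integral_Icc_eq_integral_Ioc]
  have : (volume.restrict (Ico 0 (2 * π))).real univ = 2 * π := by
    rw [measureReal_restrict_apply_univ, Real.volume_real_Ico_of_le (by positivity), sub_zero]
  rw [this, ENNReal.toReal_ofReal hlam, smul_eq_mul, smul_eq_mul]
  ring

end Geometry

/-! ### Laplace transform of the total chord length -/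

section Laplace

variable {Ω : Type*}

/-- The total length, inside the disc of radius `r` about the origin, of the lines `L i`. -/
noncomputable def totalChord (L : ℕ → Ω → ℝ × ℝ) (r : ℝ) (ω : Ω) : ℝ :=
  (pointSum L (chordLength r) ω).toReal

theorem totalChord_nonneg (L : ℕ → Ω → ℝ × ℝ) (r : ℝ) (ω : Ω) : 0 ≤ totalChord L r ω :=
  ENNReal.toReal_nonneg

theorem measurable_uncurry_totalChord [MeasurableSpace Ω] {L : ℕ → Ω → ℝ × ℝ}
    (hL : ∀ i, Measurable (L i)) :
    Measurable fun p : ℝ × Ω => totalChord L p.1 p.2 := by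
  unfold totalChord pointSum chordLength
  fun_prop

theorem measurable_totalChord [MeasurableSpace Ω] {L : ℕ → Ω → ℝ × ℝ}
    (hL : ∀ i, Measurable (L i)) (r : ℝ) :
    Measurable (totalChord L r) := by
  unfold totalChord pointSum chordLength
  fun_prop

/-- This is the Laplace functional at `s` times the chord length; integrating out the angle gives
the factor `2 * π`. -/
theorem integral_exp_neg_totalChord [MeasurableSpace Ω] {L : ℕ → Ω → ℝ × ℝ} {P : Measure Ω}
    [IsProbabilityMeasure P] {lam s r : ℝ} (hlam : 0 ≤ lam) (hL : IsPoissonProcess L (lineIntensity lam) P) (hs : 0 ≤ s)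
    (hr : 0 ≤ r) :
    ∫ ω, exp (-(s * totalChord L r ω)) ∂P = exp (-2 * π * lam * r
      + 2 * π * lam * ∫ ρ in (0 : ℝ)..r, exp (-2 * s * √(r ^ 2 - ρ ^ 2))) := by
  have h := hL.integral_exp_neg_pointSum (measurableSet_hittingLines r)
    (lineIntensity_hittingLines_ne_top hr lam) (f := fun l => s.toNNReal * chordLength r l)
    (by have := measurable_chordLength r; fun_prop)
    (fun l hl => by rw [chordLength_eq_zero hl, mul_zero])
  have h1 (ω : Ω) : (pointSum L (fun l => s.toNNReal * chordLength r l) ω).toReal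
      = s * totalChord L r ω := by
    simp only [pointSum, totalChord, ENNReal.coe_mul, ENNReal.tsum_mul_left, ENNReal.toReal_mul]
    rw [ENNReal.coe_toReal, Real.coe_toNNReal s hs]
  simp_rw [h1] at h
  rw [h]
  congr 1
  simp_rw [NNReal.coe_mul, Real.coe_toNNReal s hs, coe_chordLength]
  rw [setIntegral_hittingLines hr hlam (fun ρ => 1 - exp (-(s * (2 * √(r ^ 2 - ρ ^ 2))))),
    intervalIntegral.integral_sub (by simp) (Continuous.intervalIntegrable (by fun_prop) _ _)]
  simp_rw [show ∀ x : ℝ, -(s * (2 * x)) = -2 * s * x from fun x => by ring]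
  simp only [intervalIntegral.integral_const, sub_zero, smul_eq_mul, mul_one]
  ring

end Laplace

/-! ### Conditional Poisson law of the load of a disc -/

section Cox

variable {Ω : Type*}

/-- The number of users in the disc of radius `r` as a function of the lines and the positions. -/
noncomputable def discLoad (r : ℝ) (d : (ℕ → ℝ × ℝ) × (ℕ → ℕ → ℝ)) : ℕ∞ :=
  {p : ℕ × ℕ | (d.1 p.1).1 ^ 2 + d.2 p.1 p.2 ^ 2 ≤ r ^ 2}.encard

theorem measurable_uncurry_discLoad :
    Measurable fun x : ℝ × ((ℕ → ℝ × ℝ) × (ℕ → ℕ → ℝ)) => discLoad x.1 x.2 := by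
  refine measurable_encard_setOf (S := fun p : ℕ × ℕ =>
    {x : ℝ × ((ℕ → ℝ × ℝ) × (ℕ → ℕ → ℝ)) |
      (x.2.1 p.1).1 ^ 2 + x.2.2 p.1 p.2 ^ 2 ≤ x.1 ^ 2}) fun p => ?_
  refine measurableSet_le ?_ (by fun_prop)
  fun_prop

theorem userCount_closedBall (L : ℕ → Ω → ℝ × ℝ) (Ψ : ℕ → ℕ → Ω → ℝ) {r : ℝ} (hr : 0 ≤ r)
    (ω : Ω) : userCount L Ψ (Metric.closedBall 0 r) ω = discLoad r (coxData L Ψ ω) := by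
  simp only [userCount, discLoad, coxData, linePoint_mem_closedBall hr]

theorem discLoad_eq_sum {Ψ : ℕ → ℕ → Ω → ℝ} {r : ℝ} {l : ℕ → ℝ × ℝ}
    (hl : {i | l i ∈ hittingLines r}.Finite) (ω : Ω) :
    discLoad r (l, fun i j => Ψ i j ω)
      = ∑ i ∈ hl.toFinset, count (Ψ i) {t | (l i).1 ^ 2 + t ^ 2 ≤ r ^ 2} ω := by
  rw [← ENat.toENNReal_inj, discLoad, ← tsum_indicator_one_eq_encard, ENNReal.tsum_prod',
    tsum_eq_sum (s := hl.toFinset)]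
  · refine Eq.trans ?_ (map_sum ENat.toENNRealRingHom _ _).symm
    refine Finset.sum_congr rfl fun i _ => ?_
    change _ = ((count (Ψ i) _ ω : ℕ∞) : ℝ≥0∞)
    rw [count, ← tsum_indicator_one_eq_encard]
    rfl
  · intro i hi
    have hi' : r ^ 2 < (l i).1 ^ 2 := by
      simpa [hittingLines] using hi
    refine ENNReal.tsum_eq_zero.2 fun j => indicator_of_notMem ?_ _
    simp only [mem_ofPred_eq, not_le]
    nlinarith [sq_nonneg (Ψ i j ω)]

/-- The probability that a Poisson variable with mean `x` equals `m`. -/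
noncomputable def poissonProb (m : ℕ) (x : ℝ) : ℝ := exp (-x) * x ^ m / (m.factorial : ℝ)

theorem continuous_poissonProb (m : ℕ) : Continuous (poissonProb m) := by
  unfold poissonProb
  fun_prop

theorem poissonProb_nonneg (m : ℕ) {x : ℝ} (hx : 0 ≤ x) : 0 ≤ poissonProb m x := by
  unfold poissonProb
  positivity

theorem poissonProb_le_one (m : ℕ) {x : ℝ} (hx : 0 ≤ x) : poissonProb m x ≤ 1 := by
  have h := poissonMeasure_real_singleton x.toNNReal m
  rw [Real.coe_toNNReal x hx] at h
  rw [poissonProb, ← h]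
  exact measureReal_le_one

variable [MeasurableSpace Ω] {P : Measure Ω}

variable {L : ℕ → Ω → ℝ × ℝ} {Ψ : ℕ → ℕ → Ω → ℝ} {lamL lamV : ℝ}

theorem IsPoissonLineCox.measurable_coxData (h : IsPoissonLineCox L Ψ lamL lamV P) :
    Measurable (coxData L Ψ) := by
  have h1 := h.lines.measurable
  have h2 := fun i => (h.users i).measurable
  unfold coxData
  fun_prop

variable [IsProbabilityMeasure P]

/-- Independence makes the joint law a product, so Fubini allows `X` to be frozen without
conditional distributions. It serves for freezing the lines and, later, the area. -/
theorem measure_setOf_prodMk_mem_of_indepFun {α β : Type*} [MeasurableSpace α]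
    [MeasurableSpace β] {X : Ω → α} {Y : Ω → β} (hX : Measurable X) (hY : Measurable Y)
    (h : IndepFun X Y P) {S : Set (α × β)} (hS : MeasurableSet S) :
    P {ω | (X ω, Y ω) ∈ S} = ∫⁻ x, P {ω | (x, Y ω) ∈ S} ∂P.map X := by
  have h1 := (indepFun_iff_map_prod_eq_prod_map_map hX.aemeasurable hY.aemeasurable).1 h
  have h2 : P {ω | (X ω, Y ω) ∈ S} = P.map (fun ω => (X ω, Y ω)) S :=
    (Measure.map_apply (hX.prodMk hY) hS).symm
  rw [h2, h1, Measure.prod_apply hS]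
  refine lintegral_congr fun x => ?_
  rw [Measure.map_apply hY (measurable_prodMk_left hS)]
  rfl

/-- With the lines frozen, the load is a finite sum of independent Poisson counts on intervals of
chord length. -/
theorem measure_discLoad_eq {Ψ : ℕ → ℕ → Ω → ℝ} {lamV r : ℝ}
    (hΨ : ∀ i, IsPoissonProcess (Ψ i) (ENNReal.ofReal lamV • volume) P)
    (hind : iIndepFun (fun (i : ℕ) (ω : Ω) (j : ℕ) => Ψ i j ω) P) {l : ℕ → ℝ × ℝ}
    (hl : {i | l i ∈ hittingLines r}.Finite) (m : ℕ) :
    P {ω | discLoad r (l, fun i j => Ψ i j ω) = m}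
      = poissonMeasure (∑ i ∈ hl.toFinset, lamV.toNNReal * chordLength r (l i)) {m} := by
  set J : ℕ → Set ℝ := fun i => {t | (l i).1 ^ 2 + t ^ 2 ≤ r ^ 2} with hJ
  have hJm (i : ℕ) : MeasurableSet (J i) := measurableSet_le (by fun_prop) (by fun_prop)
  have hJv (i : ℕ) : (ENNReal.ofReal lamV • volume : Measure ℝ) (J i)
      = ((lamV.toNNReal * chordLength r (l i) : ℝ≥0) : ℝ≥0∞) := by
    rw [Measure.smul_apply, hJ, volume_setOf_sq_add_sq_le, smul_eq_mul, ENNReal.ofReal,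
      ENNReal.coe_mul]
  have hJt (i : ℕ) : (ENNReal.ofReal lamV • volume : Measure ℝ) (J i) ≠ ∞ := by
    rw [hJv]; exact ENNReal.coe_ne_top
  have hlaw (i : ℕ) : HasLaw (fun ω => (count (Ψ i) (J i) ω).toNat)
      (poissonMeasure (lamV.toNNReal * chordLength r (l i))) P := by
    have := (hΨ i).hasLaw_toNat_count (hJm i) (hJt i)
    rwa [hJv, ENNReal.toNNReal_coe] at this
  have hmN (i : ℕ) : Measurable fun ω => (count (Ψ i) (J i) ω).toNat :=
    (Measurable.of_discrete (f := ENat.toNat)).comp ((hΨ i).measurable_count (hJm i))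
  have hindN : iIndepFun (fun i ω => (count (Ψ i) (J i) ω).toNat) P :=
    -- Each count is a measurable function of the whole position sequence on its own line.
    hind.comp (fun i (x : ℕ → ℝ) => {j | x j ∈ J i}.encard.toNat) fun i =>
      (Measurable.of_discrete (f := ENat.toNat)).comp
        (measurable_encard_setOf (S := fun j => (fun x : ℕ → ℝ => x j) ⁻¹' J i)
          fun j => measurable_pi_apply j (hJm i))
  have hsum := hasLaw_sum_poissonMeasure hmN hindN hlaw hl.toFinset
  rw [← hsum.map_eq, Measure.map_apply_of_aemeasurable hsum.aemeasurable
    (measurableSet_singleton m)]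
  refine measure_congr ?_
  have hae : ∀ᵐ ω ∂P, ∀ i, count (Ψ i) (J i) ω ≠ ⊤ :=
    ae_all_iff.2 fun i => (hΨ i).ae_count_ne_top (hJm i) (hJt i)
  filter_upwards [hae] with ω hω
  change (discLoad r (l, fun i j => Ψ i j ω) = m)
    = ((∑ i ∈ hl.toFinset, fun ω => (count (Ψ i) (J i) ω).toNat) ω = m)
  rw [discLoad_eq_sum hl, Finset.sum_apply]
  have : ∑ i ∈ hl.toFinset, count (Ψ i) (J i) ω
      = ((∑ i ∈ hl.toFinset, (count (Ψ i) (J i) ω).toNat : ℕ) : ℕ∞) := by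
    rw [Nat.cast_sum]
    exact Finset.sum_congr rfl fun i _ => (ENat.natCast_toNat (hω i)).symm
  rw [this, Nat.cast_inj]

/-- Given the lines, the load of a disc is Poisson with mean proportional to the total chord
length. -/
theorem IsPoissonLineCox.measureReal_discLoad_eq (h : IsPoissonLineCox L Ψ lamL lamV P)
    (hV : 0 ≤ lamV) {r : ℝ} (hr : 0 ≤ r) (m : ℕ) :
    P.real {ω | discLoad r (coxData L Ψ ω) = m}
      = ∫ ω, poissonProb m (lamV * totalChord L r ω) ∂P := by
  have hmL : Measurable fun ω i => L i ω := measurable_pi_lambda _ h.lines.measurable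
  have hmΨ : Measurable fun ω i j => Ψ i j ω :=
    measurable_pi_lambda _ fun i => measurable_pi_lambda _ (h.users i).measurable
  have hS : MeasurableSet {d : (ℕ → ℝ × ℝ) × (ℕ → ℕ → ℝ) | discLoad r d = m} :=
    (measurable_uncurry_discLoad.comp measurable_prodMk_left) (measurableSet_singleton (m : ℕ∞))
  have hmt : Measurable (totalChord L r) := measurable_totalChord h.lines.measurable r
  have hmp : Measurable fun ω => poissonProb m (lamV * totalChord L r ω) :=
    (continuous_poissonProb m).measurable.comp (hmt.const_mul _)
  have h0 (ω : Ω) : 0 ≤ lamV * totalChord L r ω := mul_nonneg hV (totalChord_nonneg L r ω)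
  have h1 := measure_setOf_prodMk_mem_of_indepFun hmL hmΨ h.indep_lines hS
  rw [integral_eq_lintegral_of_nonneg_ae
    (Filter.Eventually.of_forall fun ω => poissonProb_nonneg m (h0 ω)) hmp.aestronglyMeasurable]
  have h2 : P {ω | discLoad r (coxData L Ψ ω) = m}
      = ∫⁻ x, P {ω | discLoad r (x, fun i j => Ψ i j ω) = m} ∂P.map fun ω i => L i ω := h1
  rw [measureReal_def, h2]
  congr 1
  have h3 : Measurable fun x : ℕ → ℝ × ℝ => P {ω | discLoad r (x, fun i j => Ψ i j ω) = m} :=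
    measurable_measure_prodMk_left (ν := P)
      (s := {p : (ℕ → ℝ × ℝ) × Ω | discLoad r (p.1, fun i j => Ψ i j p.2) = m})
      ((measurable_fst.prodMk (hmΨ.comp measurable_snd)) hS)
  rw [lintegral_map h3 hmL]
  refine lintegral_congr_ae ?_
  filter_upwards [h.lines.ae_finite (measurableSet_hittingLines r)
    (lineIntensity_hittingLines_ne_top hr lamL)] with ω hω
  refine (measure_discLoad_eq h.users h.indep_users hω m).trans ?_
  rw [poissonMeasure_singleton, poissonProb, totalChord,
    pointSum_eq_sum (fun _ => chordLength_eq_zero) hω, ENNReal.coe_toReal, ← Finset.mul_sum,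
    NNReal.coe_mul, Real.coe_toNNReal lamV hV]

end Cox

/-! ### The fitted area law and the substitution `z = π r ^ 2` -/

section AreaLaw

variable {lamB : ℝ}

theorem measurable_areaPDF (lamB : ℝ) : Measurable (areaPDF lamB) := by
  unfold areaPDF genGamma
  fun_prop

theorem areaPDF_nonneg (hB : 0 < lamB) {z : ℝ} (hz : 0 < z) : 0 ≤ areaPDF lamB z := by
  have : 0 < Gamma (3.31122 / 1.07950) := Gamma_pos_of_pos (by norm_num)
  unfold areaPDF genGamma
  positivity

theorem integrableOn_areaPDF (hB : 0 < lamB) : IntegrableOn (areaPDF lamB) (Ioi 0) := by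
  have h : IntegrableOn (genGamma 1.07950 3.03226 3.31122) (Ioi 0) := by
    have := (integrableOn_rpow_mul_exp_neg_mul_rpow (p := 1.07950) (s := 3.31122 - 1)
      (b := 3.03226) (by norm_num) (by norm_num) (by norm_num)).const_mul
      (1.07950 * 3.03226 ^ ((3.31122 : ℝ) / 1.07950) * (Gamma (3.31122 / 1.07950))⁻¹)
    refine Integrable.congr this (Filter.Eventually.of_forall fun x => ?_)
    simp only [genGamma]
    ring
  have h2 := (integrableOn_Ioi_comp_mul_left_iff (genGamma 1.07950 3.03226 3.31122) 0 hB).2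
    (by simpa using h)
  exact h2.const_mul lamB

/-- Finiteness is enough for the sequel; that the total mass is one is never needed. -/
theorem isFiniteMeasure_areaLaw (hB : 0 < lamB) : IsFiniteMeasure (areaLaw lamB) :=
  isFiniteMeasure_withDensity_ofReal (integrableOn_areaPDF hB).2

theorem ae_toReal_smul_areaPDF (hB : 0 < lamB) (F : ℝ → ℝ) :
    (fun z => (ENNReal.ofReal (areaPDF lamB z)).toReal • F z) =ᵐ[volume.restrict (Ioi 0)]
      fun z => areaPDF lamB z * F z := by
  filter_upwards [ae_restrict_mem measurableSet_Ioi] with z hz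
  rw [ENNReal.toReal_ofReal (areaPDF_nonneg hB hz), smul_eq_mul]

theorem integral_areaLaw (hB : 0 < lamB) (F : ℝ → ℝ) :
    ∫ z, F z ∂areaLaw lamB = ∫ z in Ioi 0, areaPDF lamB z * F z := by
  rw [areaLaw, integral_withDensity_eq_integral_toReal_smul
    (measurable_areaPDF lamB).ennreal_ofReal (by simp)]
  exact integral_congr_ae (ae_toReal_smul_areaPDF hB F)

theorem integrable_areaLaw_iff (hB : 0 < lamB) (F : ℝ → ℝ) :
    Integrable F (areaLaw lamB) ↔ IntegrableOn (fun z => areaPDF lamB z * F z) (Ioi 0) := by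
  rw [areaLaw, integrable_withDensity_iff_integrable_smul'
    (measurable_areaPDF lamB).ennreal_ofReal (by simp)]
  exact integrable_congr (ae_toReal_smul_areaPDF hB F)

theorem image_pi_mul_sq_Ioi : (fun r : ℝ => π * r ^ 2) '' Ioi 0 = Ioi 0 := by
  ext z
  constructor
  · rintro ⟨r, hr, rfl⟩
    have : 0 < r := hr
    exact mem_Ioi.2 (by positivity)
  · intro hz
    have hz : 0 < z := hz
    refine ⟨√(z / π), mem_Ioi.2 (by positivity), ?_⟩
    simp only
    rw [Real.sq_sqrt (by positivity)]
    field_simp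

theorem injOn_pi_mul_sq_Ioi : InjOn (fun r : ℝ => π * r ^ 2) (Ioi 0) := by
  intro a ha b hb hab
  have ha : 0 < a := ha
  have hb : 0 < b := hb
  exact (pow_left_inj₀ ha.le hb.le two_ne_zero).1 (mul_left_cancel₀ pi_ne_zero hab)

theorem hasDerivWithinAt_pi_mul_sq (r : ℝ) :
    HasDerivWithinAt (fun r : ℝ => π * r ^ 2) (2 * π * r) (Ioi 0) r := by
  have := ((hasDerivAt_pow 2 r).const_mul π).hasDerivWithinAt (s := Ioi 0)
  exact this.congr_deriv (by norm_num; ring)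

theorem abs_deriv_smul_areaPDF (lamB : ℝ) (F : ℝ → ℝ) {r : ℝ} (hr : r ∈ Ioi (0 : ℝ)) :
    |2 * π * r| • (areaPDF lamB (π * r ^ 2) * F √(π * r ^ 2 / π)) = F r * radiusPDF lamB r := by
  have hr : 0 < r := hr
  rw [mul_div_cancel_left₀ _ pi_ne_zero, Real.sqrt_sq hr.le, abs_of_pos (by positivity),
    radiusPDF, smul_eq_mul]
  ring

/-- The factor `2 * π * r` in `radiusPDF` is the Jacobian of `r ↦ π * r ^ 2`. -/
theorem integral_radiusPDF (hB : 0 < lamB) (F : ℝ → ℝ) :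
    ∫ r in Ioi 0, F r * radiusPDF lamB r = ∫ z, F √(z / π) ∂areaLaw lamB := by
  rw [integral_areaLaw hB (fun z => F √(z / π))]
  have h := integral_image_eq_integral_abs_deriv_smul measurableSet_Ioi
    (fun r _ => hasDerivWithinAt_pi_mul_sq r) injOn_pi_mul_sq_Ioi
    (fun z => areaPDF lamB z * F √(z / π))
  rw [image_pi_mul_sq_Ioi] at h
  rw [h]
  exact setIntegral_congr_fun measurableSet_Ioi fun r hr =>
    (abs_deriv_smul_areaPDF lamB F hr).symm

theorem integrableOn_radiusPDF_iff (hB : 0 < lamB) (F : ℝ → ℝ) :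
    IntegrableOn (fun r => F r * radiusPDF lamB r) (Ioi 0)
      ↔ Integrable (fun z => F √(z / π)) (areaLaw lamB) := by
  rw [integrable_areaLaw_iff hB (fun z => F √(z / π))]
  have h := integrableOn_image_iff_integrableOn_abs_deriv_smul measurableSet_Ioi
    (fun r _ => hasDerivWithinAt_pi_mul_sq r) injOn_pi_mul_sq_Ioi
    (fun z => areaPDF lamB z * F √(z / π))
  rw [image_pi_mul_sq_Ioi] at h
  rw [h]
  exact integrableOn_congr_fun (fun r hr => (abs_deriv_smul_areaPDF lamB F hr).symm)
    measurableSet_Ioi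

end AreaLaw

/-! ### Integrals against measures close in total variation -/

section TotalVariation

theorem integral_eq_intervalIntegral_measureReal_lt {α : Type*} [MeasurableSpace α]
    (μ : Measure α) [IsFiniteMeasure μ] {q : α → ℝ} (hq : Measurable q) (h0 : ∀ x, 0 ≤ q x)
    (h1 : ∀ x, q x ≤ 1) : ∫ x, q x ∂μ = ∫ t in (0 : ℝ)..1, μ.real {x | t < q x} := by
  have hint : Integrable q μ := Integrable.of_bound hq.aestronglyMeasurable 1
    (Filter.Eventually.of_forall fun x => by
      rw [Real.norm_eq_abs, abs_of_nonneg (h0 x)]; exact h1 x)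
  rw [hint.integral_eq_integral_meas_lt (Filter.Eventually.of_forall h0),
    intervalIntegral.integral_of_le zero_le_one]
  refine (setIntegral_eq_of_subset_of_forall_sdiff_eq_zero measurableSet_Ioi
    Ioc_subset_Ioi_self fun t ht => ?_)
  have ht1 : 1 < t := by
    by_contra h
    exact ht.2 ⟨ht.1, not_lt.1 h⟩
  have : {x | t < q x} = ∅ := by
    ext x
    simp only [mem_ofPred_eq, mem_empty_iff_false, iff_false, not_lt]
    exact (h1 x).trans ht1.le
  rw [this, measureReal_empty]

/-- By the layer-cake formula, the difference is an integral over `t ∈ [0, 1]` of differences on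
superlevel sets, each at most `δ`; the interval has length one, so the constant is `δ` itself. -/
theorem abs_integral_sub_integral_le_of_measureReal {α : Type*} [MeasurableSpace α]
    {μ ν : Measure α} [IsFiniteMeasure μ] [IsFiniteMeasure ν] {q : α → ℝ} (hq : Measurable q)
    (h0 : ∀ x, 0 ≤ q x) (h1 : ∀ x, q x ≤ 1) {δ : ℝ}
    (hδ : ∀ A, MeasurableSet A → |μ.real A - ν.real A| ≤ δ) :
    |∫ x, q x ∂μ - ∫ x, q x ∂ν| ≤ δ := by
  have hanti (ρ : Measure α) [IsFiniteMeasure ρ] : Antitone fun t => ρ.real {x | t < q x} :=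
    fun s t hst => measureReal_mono fun x hx => lt_of_le_of_lt hst hx
  rw [integral_eq_intervalIntegral_measureReal_lt μ hq h0 h1,
    integral_eq_intervalIntegral_measureReal_lt ν hq h0 h1,
    ← intervalIntegral.integral_sub (hanti μ).intervalIntegrable (hanti ν).intervalIntegrable]
  have := intervalIntegral.norm_integral_le_of_norm_le_const (a := 0) (b := 1) (C := δ)
    (f := fun t => μ.real {x | t < q x} - ν.real {x | t < q x})
    (fun t _ => hδ _ (measurableSet_lt measurable_const hq))
  simpa using this

end TotalVariation

/-- Viewing the area as a function of the point sequence alone lets independence of the base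
stations pass to it. The cell is a countable intersection of closed conditions, the one from the
origin being trivial. -/
theorem measurable_volume_typicalCell :
    Measurable fun φ : ℕ → Plane => volume.real (typicalCell (fun i (φ : ℕ → Plane) => φ i) φ) := by
  have : MeasurableSet {p : (ℕ → Plane) × Plane | p.2 ∈ typicalCell (fun i φ => φ i) p.1} := by
    have h : {p : (ℕ → Plane) × Plane | p.2 ∈ typicalCell (fun i φ => φ i) p.1}
        = ⋂ i, {p | ‖p.2‖ ≤ ‖p.2 - p.1 i‖} := by
      ext p
      simp [typicalCell, voronoiCell]
    rw [h]
    exact MeasurableSet.iInter fun i => measurableSet_le (by fun_prop) (by fun_prop)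
  exact (measurable_measure_prodMk_left (ν := (volume : Measure Plane)) this).ennreal_toReal

/-! ### The moment generating function and the load probabilities -/

section Load

variable {Ω : Type*} [MeasurableSpace Ω] {P : Measure Ω} [IsProbabilityMeasure P]
  {L : ℕ → Ω → ℝ × ℝ} {Ψ : ℕ → ℕ → Ω → ℝ} {lamB lamL lamV : ℝ}

/-- The negative of the total chord length in a disc of area `p.1`. -/
noncomputable def negChord (L : ℕ → Ω → ℝ × ℝ) (p : ℝ × Ω) : ℝ := -totalChord L √(p.1 / π) p.2

theorem measurable_negChord (hL : ∀ i, Measurable (L i)) : Measurable (negChord L) :=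
  ((measurable_uncurry_totalChord hL).comp
    (g := fun p : ℝ × Ω => totalChord L p.1 p.2) (f := fun p : ℝ × Ω => (√(p.1 / π), p.2))
    (by fun_prop)).neg

theorem integrable_exp_mul_negChord (hL : ∀ i, Measurable (L i)) {μ : Measure (ℝ × Ω)}
    [IsFiniteMeasure μ] {s : ℝ} (hs : 0 ≤ s) : Integrable (fun p => exp (s * negChord L p)) μ := by
  have hm := measurable_negChord hL
  refine Integrable.of_bound (by fun_prop : Measurable _).aestronglyMeasurable 1
    (Filter.Eventually.of_forall fun p => ?_)
  rw [Real.norm_eq_abs, abs_of_pos (exp_pos _), exp_le_one_iff]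
  exact mul_nonpos_of_nonneg_of_nonpos hs (neg_nonpos.2 (totalChord_nonneg _ _ _))

/-- Being interior to the domain of finiteness is what permits differentiation under the
expectation. -/
theorem mem_interior_integrableExpSet_negChord (hL : ∀ i, Measurable (L i)) {μ : Measure (ℝ × Ω)}
    [IsFiniteMeasure μ] {s : ℝ} (hs : 0 < s) : s ∈ interior (integrableExpSet (negChord L) μ) :=
  mem_interior.2 ⟨Ioi 0, fun _ ht => integrable_exp_mul_negChord hL (le_of_lt ht), isOpen_Ioi, hs⟩

theorem integral_exp_mul_negChord (hL : 0 ≤ lamL)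
    (hlines : IsPoissonProcess L (lineIntensity lamL) P) {s : ℝ} (hs : 0 ≤ s) (z : ℝ) :
    ∫ ω, exp (s * negChord L (z, ω)) ∂P = exp (-2 * π * lamL * √(z / π)
      + 2 * π * lamL * ∫ ρ in (0 : ℝ)..√(z / π), exp (-2 * s * √(√(z / π) ^ 2 - ρ ^ 2))) := by
  rw [← integral_exp_neg_totalChord hL hlines hs (Real.sqrt_nonneg _)]
  simp only [negChord, mul_neg]

/-- After the substitution, the integrand is a partial integral of a bounded function on a finite
product measure. -/
theorem integrableOn_laplaceIntegrand (hB : 0 < lamB) (hL : 0 ≤ lamL)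
    (hlines : IsPoissonProcess L (lineIntensity lamL) P) {s : ℝ} (hs : 0 ≤ s) :
    IntegrableOn (laplaceIntegrand lamB lamL s) (Ioi 0) := by
  have := isFiniteMeasure_areaLaw hB
  refine (integrableOn_radiusPDF_iff hB fun r => exp (-2 * π * lamL * r + 2 * π * lamL *
    ∫ ρ in (0 : ℝ)..r, exp (-2 * s * √(r ^ 2 - ρ ^ 2)))).2 ?_
  simp_rw [← integral_exp_mul_negChord hL hlines hs]
  exact (integrable_exp_mul_negChord hlines.measurable hs).integral_prod_left

theorem approxLaplace_eq_mgf (hB : 0 < lamB) (hL : 0 ≤ lamL)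
    (hlines : IsPoissonProcess L (lineIntensity lamL) P) {s : ℝ} (hs : 0 ≤ s) :
    approxLaplace lamB lamL s = mgf (negChord L) ((areaLaw lamB).prod P) s := by
  have := isFiniteMeasure_areaLaw hB
  rw [mgf, integral_prod _ (integrable_exp_mul_negChord hlines.measurable hs)]
  simp_rw [integral_exp_mul_negChord hL hlines hs]
  exact integral_radiusPDF hB fun r => exp (-2 * π * lamL * r + 2 * π * lamL *
    ∫ ρ in (0 : ℝ)..r, exp (-2 * s * √(r ^ 2 - ρ ^ 2)))

theorem contDiffOn_approxLaplace (hB : 0 < lamB) (hL : 0 ≤ lamL)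
    (hlines : IsPoissonProcess L (lineIntensity lamL) P) :
    ContDiffOn ℝ ((⊤ : ℕ∞) : WithTop ℕ∞) (fun s => approxLaplace lamB lamL s) (Ioi 0) := by
  have := isFiniteMeasure_areaLaw hB
  refine ContDiffOn.congr (f := mgf (negChord L) ((areaLaw lamB).prod P)) (fun s hs => ?_)
    fun s hs => approxLaplace_eq_mgf hB hL hlines (le_of_lt hs)
  exact (analyticAt_mgf
    (mem_interior_integrableExpSet_negChord hlines.measurable hs)).contDiffAt.contDiffWithinAt

theorem approxLoadPMF_eq_integral (hB : 0 < lamB) (hV : 0 < lamV)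
    (hL : 0 ≤ lamL) (h : IsPoissonLineCox L Ψ lamL lamV P) (m : ℕ) :
    approxLoadPMF lamB lamL lamV m
      = ∫ z, P.real {ω | userCount L Ψ (discOfArea z) ω = m} ∂areaLaw lamB := by
  have := isFiniteMeasure_areaLaw hB
  have hm := measurable_negChord h.lines.measurable
  -- The two functions are identified only for `s ≥ 0`; `lamV > 0` gives the neighbourhood needed
  -- for derivatives.
  have hev : (fun s => approxLaplace lamB lamL s)
      =ᶠ[nhds lamV] mgf (negChord L) ((areaLaw lamB).prod P) :=
    Filter.eventually_of_mem (Ioi_mem_nhds hV) fun s hs =>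
      approxLaplace_eq_mgf hB hL h.lines (le_of_lt hs)
  -- The signs from `(-lamV) ^ m` and `(-T) ^ m` cancel.
  have hpt (p : ℝ × Ω) : (-lamV) ^ m / (m.factorial : ℝ)
      * (negChord L p ^ m * exp (lamV * negChord L p))
        = poissonProb m (lamV * totalChord L √(p.1 / π) p.2) := by
    rw [negChord, poissonProb, mul_neg, neg_pow lamV, neg_pow (totalChord L _ _), mul_pow]
    have : ((-1 : ℝ) ^ m) * (-1) ^ m = 1 := by rw [← mul_pow]; simp
    linear_combination (lamV ^ m / (m.factorial : ℝ) * totalChord L √(p.1 / π) p.2 ^ m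
      * exp (-(lamV * totalChord L √(p.1 / π) p.2))) * this
  have hmt : Measurable fun p : ℝ × Ω => poissonProb m (lamV * totalChord L √(p.1 / π) p.2) := by
    simp_rw [← hpt]
    fun_prop
  have h0 (p : ℝ × Ω) : 0 ≤ lamV * totalChord L √(p.1 / π) p.2 :=
    mul_nonneg hV.le (totalChord_nonneg _ _ _)
  have hint : Integrable (fun p : ℝ × Ω => poissonProb m (lamV * totalChord L √(p.1 / π) p.2))
      ((areaLaw lamB).prod P) :=
    Integrable.of_bound hmt.aestronglyMeasurable 1 (Filter.Eventually.of_forall fun p => by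
      rw [Real.norm_eq_abs, abs_of_nonneg (poissonProb_nonneg m (h0 p))]
      exact poissonProb_le_one m (h0 p))
  rw [approxLoadPMF, hev.iteratedDeriv_eq,
    iteratedDeriv_mgf (mem_interior_integrableExpSet_negChord h.lines.measurable hV),
    ← integral_const_mul]
  simp_rw [hpt]
  rw [integral_prod _ hint]
  refine integral_congr_ae (Filter.Eventually.of_forall fun z => ?_)
  simp only [discOfArea, userCount_closedBall L Ψ (Real.sqrt_nonneg _)]
  exact (h.measureReal_discLoad_eq hV.le (Real.sqrt_nonneg _) m).symm

theorem measurable_measureReal_userCount_discOfArea (h : IsPoissonLineCox L Ψ lamL lamV P)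
    (m : ℕ) : Measurable fun z => P.real {ω | userCount L Ψ (discOfArea z) ω = m} := by
  simp only [discOfArea, userCount_closedBall L Ψ (Real.sqrt_nonneg _)]
  have hS : MeasurableSet {p : ℝ × Ω | discLoad √(p.1 / π) (coxData L Ψ p.2) = m} :=
    (measurable_uncurry_discLoad.comp
      (f := fun p : ℝ × Ω => (√(p.1 / π), coxData L Ψ p.2))
      (by have := h.measurable_coxData; fun_prop)) (measurableSet_singleton (m : ℕ∞))
  exact (measurable_measure_prodMk_left hS).ennreal_toReal

theorem measureReal_userCount_discOfArea_of_indepFun (h : IsPoissonLineCox L Ψ lamL lamV P)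
    {Z : Ω → ℝ} (hZ : Measurable Z) (hind : IndepFun Z (coxData L Ψ) P) (m : ℕ) :
    P.real {ω | userCount L Ψ (discOfArea (Z ω)) ω = m}
      = ∫ z, P.real {ω | userCount L Ψ (discOfArea z) ω = m} ∂P.map Z := by
  have hm := measurable_measureReal_userCount_discOfArea h m
  rw [integral_eq_lintegral_of_nonneg_ae (Filter.Eventually.of_forall fun z => measureReal_nonneg)
    hm.aestronglyMeasurable, measureReal_def]
  congr 1
  rw [lintegral_congr fun z => ofReal_measureReal]
  simp only [discOfArea, userCount_closedBall L Ψ (Real.sqrt_nonneg _)]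
  exact measure_setOf_prodMk_mem_of_indepFun hZ h.measurable_coxData hind
    (S := {x | discLoad √(x.1 / π) x.2 = m})
    ((measurable_uncurry_discLoad.comp
      (f := fun p : ℝ × ((ℕ → ℝ × ℝ) × (ℕ → ℕ → ℝ)) => (√(p.1 / π), p.2))
      (by fun_prop)) (measurableSet_singleton (m : ℕ∞)))

end Load

end VehicularLoad

open VehicularLoad in
/-- The first two conjuncts say that the displayed expression is meaningful. The third is the load
PMF when the typical cell is replaced by a disc of equal area with the fitted area law. The fourth
makes the approximation of the true load on the typical cell precise: it is exact up to the error
`ε` of the disc assumption and the error `δ` of the fitted area law; in particular it is an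
equality if both assumptions hold exactly. -/
theorem theorem2 {Ω : Type*} [MeasurableSpace Ω] (P : Measure Ω) [IsProbabilityMeasure P]
    (lamB lamL lamV : ℝ) (hB : 0 < lamB) (hL : 0 < lamL) (hV : 0 < lamV)
    (L : ℕ → Ω → ℝ × ℝ) (Ψ : ℕ → ℕ → Ω → ℝ) (hcox : IsPoissonLineCox L Ψ lamL lamV P) :
    (∀ s : ℝ, 0 < s → IntegrableOn (laplaceIntegrand lamB lamL s) (Ioi 0)) ∧
    ContDiffOn ℝ ((⊤ : ℕ∞) : WithTop ℕ∞) (fun s => approxLaplace lamB lamL s) (Ioi 0) ∧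
    (∀ Z : Ω → ℝ, Measurable Z → P.map Z = areaLaw lamB → IndepFun Z (coxData L Ψ) P →
      ∀ m : ℕ, P.real {ω | userCount L Ψ (discOfArea (Z ω)) ω = m}
        = approxLoadPMF lamB lamL lamV m) ∧
    (∀ Φ : ℕ → Ω → Plane, IsPoissonProcess Φ (ENNReal.ofReal lamB • volume) P →
      IndepFun (fun (ω : Ω) (i : ℕ) => Φ i ω) (coxData L Ψ) P →
      ∀ (m : ℕ) (ε δ : ℝ),
        |P.real {ω | userCount L Ψ (typicalCell Φ ω) ω = m}
          - P.real {ω | userCount L Ψ (discOfArea (volume.real (typicalCell Φ ω))) ω = m}| ≤ ε →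
        (∀ A : Set ℝ, MeasurableSet A →
          |P.real {ω | volume.real (typicalCell Φ ω) ∈ A} - (areaLaw lamB).real A| ≤ δ) →
        |P.real {ω | userCount L Ψ (typicalCell Φ ω) ω = m}
          - approxLoadPMF lamB lamL lamV m| ≤ ε + δ) := by
  have := isFiniteMeasure_areaLaw hB
  refine ⟨fun s hs => integrableOn_laplaceIntegrand hB hL.le hcox.lines hs.le,
    contDiffOn_approxLaplace hB hL.le hcox.lines, fun Z hZ hlaw hind m => ?_,
    fun Φ hΦ hind m ε δ hε hδ => ?_⟩
  · rw [measureReal_userCount_discOfArea_of_indepFun hcox hZ hind, hlaw,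
      approxLoadPMF_eq_integral hB hV hL.le hcox]
  · have hmΦ : Measurable fun ω i => Φ i ω := measurable_pi_lambda _ hΦ.measurable
    have hZ : Measurable fun ω => volume.real (typicalCell Φ ω) :=
      measurable_volume_typicalCell.comp hmΦ
    -- The cell area depends on the base stations only, so the equal-area disc falls under the
    -- frozen-area formula.
    have hindZ : IndepFun (fun ω => volume.real (typicalCell Φ ω)) (coxData L Ψ) P :=
      hind.comp measurable_volume_typicalCell measurable_id
    have hdisc : |P.real {ω | userCount L Ψ (discOfArea (volume.real (typicalCell Φ ω))) ω = m}
        - approxLoadPMF lamB lamL lamV m| ≤ δ := by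
      have := Measure.isProbabilityMeasure_map (μ := P) hZ.aemeasurable
      rw [measureReal_userCount_discOfArea_of_indepFun hcox hZ hindZ,
        approxLoadPMF_eq_integral hB hV hL.le hcox]
      refine abs_integral_sub_integral_le_of_measureReal
        (measurable_measureReal_userCount_discOfArea hcox m) (fun z => measureReal_nonneg)
        (fun z => measureReal_le_one) fun A hA => ?_
      rw [map_measureReal_apply hZ hA]
      exact hδ A hA
    exact (abs_sub_le _ _ _).trans (add_le_add hε hdisc)
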